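/- Let $F$ be a field with $\operatorname{char} F\neq 2$, let $G$ be a group and let $\sigma:G\to\{\pm1\}$ be a nontrivial homomorphism (an orientation of $G$). Let $*$ be the oriented classical involution of the group algebra $FG$, $$\Big(\sum_{g\in G}\alpha_g g\Big)^{*}=\sum_{g\in G}\alpha_g\,\sigma(g)\,g^{-1},$$ put $(FG)^{+}=\{\alpha\in FG:\alpha^{*}=\alpha\}$, and let $\mathcal U^{+}(FG)$ be the set of units of $FG$ lying in $(FG)^{+}$. For a nonempty subset $S$ of a ring put $\gamma^{1}(S)=S$ and let $\gamma^{n+1}(S)$ be the additive subgroup generated by all $xy-yx$ with $x\in\gamma^{n}(S)$, $y\in S$; $S$ is Lie nilpotent if $\gamma^{n}(S)=0$ for some $n\ge 1$. For a nonempty subset $H$ of a group put $\gamma_{1}(H)=H$ and let $\gamma_{n+1}(H)$ be the subgroup generated by all $x^{-1}y^{-1}xy$ with $x\in\gamma_{n}(H)$, $y\in H$; $H$ is nilpotent if $\gamma_{n}(H)=1$ for some $n\ge 1$. If $G$ contains a subgroup isomorphic to the quaternion group $Q_8$ of order $8$ and $(FG)^{+}$ is Lie nilpotent, then $\mathcal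 U^{+}(FG)$ is nilpotent. -/

import Mathlib

namespace OrientedGroupAlgebra

/-- The lower Lie central series of a subset `S` of an associative ring, with the index shifted
by one: `lieLowerCentral S n` is `γ^{n+1}(S)`, that is, `γ^1(S) = S` and `γ^{n+1}(S)` is the
additive subgroup generated by all `xy - yx` with `x ∈ γ^n(S)` and `y ∈ S`. -/
def lieLowerCentral {R : Type*} [Ring R] (S : Set R) : ℕ → Set R
  | 0 => S
  | n + 1 =>
      (AddSubgroup.closure {r : R | ∃ x ∈ lieLowerCentral S n, ∃ y ∈ S, r = x * y - y * x} : Set R)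

/-- A subset `S` of an associative ring is Lie nilpotent if `γ^n(S) = 0` for some `n ≥ 1`. -/
def IsLieNilpotentSet {R : Type*} [Ring R] (S : Set R) : Prop :=
  ∃ n : ℕ, lieLowerCentral S n = {0}

/-- The lower central series of a subset `H` of a group, with the index shifted by one:
`groupLowerCentral H n` is `γ_{n+1}(H)`, that is, `γ_1(H) = H` and `γ_{n+1}(H)` is the subgroup
generated by all `(x, y) = x⁻¹ y⁻¹ x y` with `x ∈ γ_n(H)` and `y ∈ H`. -/
def groupLowerCentral {U : Type*} [Group U] (H : Set U) : ℕ → Set U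
  | 0 => H
  | n + 1 =>
      (Subgroup.closure
        {u : U | ∃ x ∈ groupLowerCentral H n, ∃ y ∈ H, u = x⁻¹ * y⁻¹ * x * y} : Set U)

/-- A subset `H` of a group is nilpotent if `γ_n(H) = 1` for some `n ≥ 1`. -/
def IsNilpotentSet {U : Type*} [Group U] (H : Set U) : Prop :=
  ∃ n : ℕ, groupLowerCentral H n = {1}

/-- The oriented classical involution `∑ α_g g ↦ ∑ α_g σ(g) g⁻¹` of the group algebra `FG`
attached to an orientation `σ : G → {±1}`. -/
noncomputable def orientedInvolution {F G : Type*} [Field F] [Group G] (σ : G →* ℤˣ)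
    (a : MonoidAlgebra F G) : MonoidAlgebra F G :=
  a.coeff.sum fun g r => MonoidAlgebra.single g⁻¹ (r * (((σ g : ℤˣ) : ℤ) : F))

/-- The set `(FG)⁺` of symmetric elements under the oriented classical involution. -/
def symmetricElements (F : Type*) {G : Type*} [Field F] [Group G] (σ : G →* ℤˣ) :
    Set (MonoidAlgebra F G) :=
  {a | orientedInvolution σ a = a}

/-- The set `𝒰⁺(FG)` of symmetric units, as a subset of the unit group of `FG`. -/
def symmetricUnits (F : Type*) {G : Type*} [Field F] [Group G] (σ : G →* ℤˣ) :
    Set (MonoidAlgebra F G)ˣ :=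
  {u | (u : MonoidAlgebra F G) ∈ symmetricElements F σ}

end OrientedGroupAlgebra

/-!
The symmetric elements `S = (FG)⁺` form an additive subgroup that contains `1` and `1/2` and is
closed under the Jordan product `x ∘ y = xy + yx`, and the inverse of a symmetric unit is symmetric.
This is all the proof uses about `FG`: a Jordan-closed subgroup `S` which is Lie nilpotent generates
a ring `A` whose whole unit group is nilpotent.

The proof is by induction on the length of the Lie central series of `S`. Its last nonzero term
`Z = γ^m(S)` commutes with `S`, hence is central in `A`. The point is that `Z * Z = 0` when `m ≥ 3`
(`mul_eq_zero_of_mem_lieLowerCentral`). If `ad a` maps `S` into the centre, then so it does to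
`s ∘ t`, which forces `[a, s][t, u] = -[a, t][s, u]` (`lie_mul_lie_swap`). As double commutators of
elements of `S` are again in `S`, this skew-symmetry lets one replace the factor `[a, s]` by
`[a, c]` with `c` deep in the series, which is zero; only for `m = 3` is a separate argument needed,
where the product `[[p, q], s][[t, u], v]` turns out to be alternating in all six entries and
invariant under an odd permutation (`lie_lie_mul_lie_lie_eq_zero`).

The ideal `I = Z A` has square zero, and the induction hypothesis applies to the image of `S` in
`A / I`. To lift nilpotency of the unit group from `A / I` to `A` one has to know that the units act
unipotently on `I` by conjugation. Since `Z` is central and kills `I`, this action comes from the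
conjugation action on `A / I`; so unipotence of the action of the units on the whole ring is carried
along in the induction (`conjSeries_eq_bot_of_extension`,
`lowerCentralSeries_units_eq_bot_of_extension`).

The induction starts with `γ^3(S) = 0`, where `Z * Z` need not vanish. There `A` is spanned by `S`
over its centre, so all commutators of `A` are central (`lie_mem_center_of_closure_eq_top`), and
`[x⁻¹, a][x, b] = -[x⁻¹, x][a, b] = 0` makes the unit group nilpotent of class two.
-/

namespace OrientedGroupAlgebra

/-! ### Central commutators -/

section Commutators

variable {R : Type*} [Ring R]

/-- A central factor can be pulled out of a commutator. -/
theorem lie_central_mul {z : R} (hz : z ∈ Subring.center R) (b v : R) :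
    ⁅z * b, v⁆ = z * ⁅b, v⁆ := by
  have h := Subring.mem_center_iff.1 hz v
  rw [Ring.lie_def, Ring.lie_def, mul_sub, mul_assoc, ← mul_assoc v, h, mul_assoc]

theorem central_mul_lie {z : R} (hz : z ∈ Subring.center R) (b v : R) :
    ⁅b, z * v⁆ = z * ⁅b, v⁆ := by
  have h := Subring.mem_center_iff.1 hz b
  rw [Ring.lie_def, Ring.lie_def, mul_sub, ← mul_assoc b, h, mul_assoc, mul_assoc]

theorem lie_eq_zero_of_mem_center {z : R} (hz : z ∈ Subring.center R) (v : R) : ⁅z, v⁆ = 0 := by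
  rw [Ring.lie_def, Subring.mem_center_iff.1 hz v, sub_self]

theorem two_mul_cancel (h2 : IsUnit (2 : R)) {x : R} (h : 2 * x = 0) : x = 0 :=
  h2.mul_right_eq_zero.1 h

/-- An element commuting with a generating set is central. -/
theorem mem_center_of_forall_lie_eq_zero {S : Set R} (hS : Subring.closure S = ⊤) {z : R}
    (hz : ∀ s ∈ S, ⁅z, s⁆ = 0) : z ∈ Subring.center R := by
  have h : Subring.closure S ≤ Subring.centralizer {z} := by
    rw [Subring.closure_le]
    intro s hs
    rw [SetLike.mem_coe, Subring.mem_centralizer_iff]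
    rintro _ rfl
    exact sub_eq_zero.1 (hz s hs)
  rw [hS] at h
  rw [Subring.mem_center_iff]
  intro g
  exact ((Subring.mem_centralizer_iff.1 (h (Subring.mem_top g))) z rfl).symm

variable {S : AddSubgroup R}

/-- A subgroup closed under the Jordan product is closed under double commutators, because
`[[s, t], u] = s ∘ (t ∘ u) - t ∘ (s ∘ u)`. -/
theorem lie_lie_mem (hJ : ∀ x ∈ S, ∀ y ∈ S, x * y + y * x ∈ S) {s t u : R}
    (hs : s ∈ S) (ht : t ∈ S) (hu : u ∈ S) : ⁅⁅s, t⁆, u⁆ ∈ S := by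
  have e : ⁅⁅s, t⁆, u⁆ = (s * (t * u + u * t) + (t * u + u * t) * s)
      - (t * (s * u + u * s) + (s * u + u * s) * t) := by
    simp only [Ring.lie_def]; noncomm_ring
  rw [e]
  exact S.sub_mem (hJ _ hs _ (hJ _ ht _ hu)) (hJ _ ht _ (hJ _ hs _ hu))

/-- If `ad a` sends `S` into the centre, then `[a, s][t, u]` is skew-symmetric in `s` and `t`:
the element `[a, s ∘ t] = 2([a, s] t + [a, t] s)` is central. -/
theorem lie_mul_lie_swap (h2 : IsUnit (2 : R)) (hJ : ∀ x ∈ S, ∀ y ∈ S, x * y + y * x ∈ S)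
    {a : R} (ha : ∀ s ∈ S, ⁅a, s⁆ ∈ Subring.center R) {s t : R} (hs : s ∈ S) (ht : t ∈ S)
    (u : R) : ⁅a, s⁆ * ⁅t, u⁆ = -(⁅a, t⁆ * ⁅s, u⁆) := by
  have cs := Subring.mem_center_iff.1 (ha s hs)
  have ct := Subring.mem_center_iff.1 (ha t ht)
  have e : ⁅a, s * t + t * s⁆ = 2 * (⁅a, s⁆ * t + ⁅a, t⁆ * s) := by
    have e' : ⁅a, s * t + t * s⁆ = ⁅a, s⁆ * t + s * ⁅a, t⁆ + ⁅a, t⁆ * s + t * ⁅a, s⁆ := by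
      simp only [Ring.lie_def]; noncomm_ring
    rw [e', cs t, ct s]; noncomm_ring
  have h := lie_eq_zero_of_mem_center (ha _ (hJ s hs t ht)) u
  have e2 : ⁅2 * (⁅a, s⁆ * t + ⁅a, t⁆ * s), u⁆ = 2 * (⁅⁅a, s⁆ * t, u⁆ + ⁅⁅a, t⁆ * s, u⁆) := by
    simp only [Ring.lie_def]; noncomm_ring
  rw [e, e2, lie_central_mul (ha s hs), lie_central_mul (ha t ht)] at h
  exact eq_neg_of_add_eq_zero_left (two_mul_cancel h2 h)

/-- The case in which `ad a` also kills `t`. -/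
theorem lie_mul_lie_eq_zero (h2 : IsUnit (2 : R)) (hJ : ∀ x ∈ S, ∀ y ∈ S, x * y + y * x ∈ S)
    {a : R} (ha : ∀ s ∈ S, ⁅a, s⁆ ∈ Subring.center R) {s t : R} (hs : s ∈ S) (ht : t ∈ S)
    (hat : ⁅a, t⁆ = 0) (u : R) : ⁅a, s⁆ * ⁅t, u⁆ = 0 := by
  rw [lie_mul_lie_swap h2 hJ ha hs ht, hat, zero_mul, neg_zero]

theorem lie_mul_lie_lie_swap (h2 : IsUnit (2 : R)) (hJ : ∀ x ∈ S, ∀ y ∈ S, x * y + y * x ∈ S)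
    {a : R} (ha : ∀ s ∈ S, ⁅a, s⁆ ∈ Subring.center R) {s t : R} (hs : s ∈ S) (ht : t ∈ S)
    (u v : R) : ⁅a, s⁆ * ⁅⁅t, u⁆, v⁆ = -(⁅a, t⁆ * ⁅⁅s, u⁆, v⁆) := by
  have e : ⁅-(⁅a, t⁆ * ⁅s, u⁆), v⁆ = -⁅⁅a, t⁆ * ⁅s, u⁆, v⁆ := by
    simp only [Ring.lie_def]; noncomm_ring
  rw [← lie_central_mul (ha s hs), lie_mul_lie_swap h2 hJ ha hs ht, e, lie_central_mul (ha t ht)]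

theorem mul_lie_lie_swap (z t u v : R) : z * ⁅⁅t, u⁆, v⁆ = -(z * ⁅⁅u, t⁆, v⁆) := by
  simp only [Ring.lie_def]; noncomm_ring

/-- The expression `[a, s][[t, u], v]` is skew-symmetric in `s, t, u`. Adding two instances of the
Jacobi identity shows that it is skew-symmetric in `s` and `v` as well. -/
theorem lie_mul_lie_lie_swap_last (h2 : IsUnit (2 : R))
    (hJ : ∀ x ∈ S, ∀ y ∈ S, x * y + y * x ∈ S) {a : R}
    (ha : ∀ s ∈ S, ⁅a, s⁆ ∈ Subring.center R) {s t u v : R} (hs : s ∈ S) (hu : u ∈ S)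
    (hv : v ∈ S) :
    ⁅a, s⁆ * ⁅⁅t, u⁆, v⁆ = -(⁅a, v⁆ * ⁅⁅t, u⁆, s⁆) := by
  have jac : ∀ z x y w : R, z * ⁅⁅x, y⁆, w⁆ + z * ⁅⁅y, w⁆, x⁆ + z * ⁅⁅w, x⁆, y⁆ = 0 := by
    intro z x y w
    simp only [Ring.lie_def]; noncomm_ring
  have j1 := jac ⁅a, s⁆ v t u
  have j2 := jac ⁅a, v⁆ s t u
  have a1 := lie_mul_lie_lie_swap h2 hJ ha hs hv t u
  have b1 := lie_mul_lie_lie_swap h2 hJ ha hs hu v t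
  have b2 := mul_lie_lie_swap ⁅a, u⁆ s v t
  have b3 := lie_mul_lie_lie_swap h2 hJ ha hu hv s t
  linear_combination (norm := abel) j1 + j2 - a1 - b1 + b2 - b3

/-- If all triple commutators of elements of `S` are central, then any two of them have product
zero: the product is an alternating function of the six entries, while interchanging the two
(commuting) factors is an odd permutation of the entries. -/
theorem lie_lie_mul_lie_lie_eq_zero (h2 : IsUnit (2 : R))
    (hJ : ∀ x ∈ S, ∀ y ∈ S, x * y + y * x ∈ S)
    (hc : ∀ s ∈ S, ∀ t ∈ S, ∀ u ∈ S, ⁅⁅s, t⁆, u⁆ ∈ Subring.center R) {p q s t u v : R}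
    (hp : p ∈ S) (hq : q ∈ S) (hs : s ∈ S) (ht : t ∈ S) (hu : u ∈ S) (hv : v ∈ S) :
    ⁅⁅p, q⁆, s⁆ * ⁅⁅t, u⁆, v⁆ = 0 := by
  -- Each swap is named after the two positions it interchanges.
  let g : S → S → S → S → S → S → R := fun p q s t u v =>
    ⁅⁅(p : R), (q : R)⁆, (s : R)⁆ * ⁅⁅(t : R), (u : R)⁆, (v : R)⁆
  have hcomm : ∀ p q s t u v, g p q s t u v = g t u v p q s := fun p q s t u v =>
    Subring.mem_center_iff.1 (hc t t.2 u u.2 v v.2) _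
  have h45 : ∀ p q s t u v, g p q s t u v = -g p q s u t v := fun p q s t u v =>
    mul_lie_lie_swap _ _ _ _
  have h12 : ∀ p q s t u v, g p q s t u v = -g q p s t u v := fun p q s t u v => by
    rw [hcomm, h45, hcomm]
  have h34 : ∀ p q s t u v, g p q s t u v = -g p q t s u v := fun p q s t u v =>
    lie_mul_lie_lie_swap h2 hJ (fun x hx => hc p p.2 q q.2 x hx) s.2 t.2 _ _
  have h36 : ∀ p q s t u v, g p q s t u v = -g p q v t u s := fun p q s t u v =>
    lie_mul_lie_lie_swap_last h2 hJ (fun x hx => hc p p.2 q q.2 x hx) s.2 u.2 v.2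
  have h16 : ∀ p q s t u v, g p q s t u v = -g v q s t u p := fun p q s t u v => by
    rw [hcomm, h34, hcomm]
  have h14 : ∀ p q s t u v, g p q s t u v = -g t q s p u v := fun p q s t u v => by
    rw [h16, h36, h34, h36, h16]; simp only [neg_neg]
  have h25 : ∀ p q s t u v, g p q s t u v = -g p u s t q v := fun p q s t u v => by
    rw [h12, h45, h14, h12, h45]; simp only [neg_neg]
  have key : ∀ p q s t u v, g p q s t u v = 0 := fun p q s t u v => by
    have h : g p q s t u v = -g p q s t u v := by
      conv_lhs => rw [h14, h25, h36, hcomm]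
      simp only [neg_neg]
    exact two_mul_cancel h2 (by rw [two_mul]; nth_rewrite 1 [h]; exact neg_add_cancel _)
  exact key ⟨p, hp⟩ ⟨q, hq⟩ ⟨s, hs⟩ ⟨t, ht⟩ ⟨u, hu⟩ ⟨v, hv⟩

end Commutators

/-! ### The Lie central series of a set -/

section LieSeries

variable {R : Type*} [Ring R]

theorem lie_mem_lieLowerCentral {S : Set R} {n : ℕ} {x y : R} (hx : x ∈ lieLowerCentral S n)
    (hy : y ∈ S) : ⁅x, y⁆ ∈ lieLowerCentral S (n + 1) :=
  AddSubgroup.subset_closure ⟨x, hx, y, hy, rfl⟩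

theorem lieLowerCentral_induction {S : Set R} {n : ℕ} {K : AddSubgroup R}
    (h : ∀ x ∈ lieLowerCentral S n, ∀ y ∈ S, ⁅x, y⁆ ∈ K) {x : R}
    (hx : x ∈ lieLowerCentral S (n + 1)) : x ∈ K := by
  refine (AddSubgroup.closure_le K).2 ?_ hx
  rintro _ ⟨x, hx, y, hy, rfl⟩
  exact h x hx y hy

theorem lieLowerCentral_succ_eq_zero {S : Set R} {n : ℕ} (h : lieLowerCentral S n = {0}) :
    lieLowerCentral S (n + 1) = {0} := by
  refine Set.Subset.antisymm (fun x hx => ?_) ?_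
  · refine lieLowerCentral_induction (K := ⊥) (fun x hx y _ => ?_) hx
    rw [h] at hx
    rw [Set.mem_singleton_iff.1 hx, Ring.lie_def, zero_mul, mul_zero, sub_zero]
    exact zero_mem _
  · rintro _ rfl
    exact AddSubgroup.zero_mem _

theorem image_lieLowerCentral {R' : Type*} [Ring R'] (f : R →+* R') (S : Set R) (n : ℕ) :
    f '' lieLowerCentral S n = lieLowerCentral (f '' S) n := by
  induction n with
  | zero => rfl
  | succ n ih =>
    have h := congrArg (fun K : AddSubgroup R' => (K : Set R')) ((f : R →+ R').map_closure
      {r : R | ∃ x ∈ lieLowerCentral S n, ∃ y ∈ S, r = x * y - y * x})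
    refine h.trans ?_
    simp only [lieLowerCentral, ← ih]
    congr 2
    ext r
    constructor
    · rintro ⟨_, ⟨x, hx, y, hy, rfl⟩, rfl⟩
      exact ⟨f x, ⟨x, hx, rfl⟩, f y, ⟨y, hy, rfl⟩, by simp⟩
    · rintro ⟨_, ⟨x, hx, rfl⟩, _, ⟨y, hy, rfl⟩, rfl⟩
      exact ⟨x * y - y * x, ⟨x, hx, y, hy, rfl⟩, by simp⟩

variable {S : AddSubgroup R}

/-- The terms `γ^{2k+1}(S)` stay inside a Jordan-closed subgroup `S`. -/
theorem lieLowerCentral_two_mul_subset (hJ : ∀ x ∈ S, ∀ y ∈ S, x * y + y * x ∈ S) (k : ℕ) :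
    lieLowerCentral (S : Set R) (2 * k) ⊆ S := by
  induction k with
  | zero => exact subset_rfl
  | succ k ih =>
    intro x hx
    refine lieLowerCentral_induction (fun b hb v hv => ?_) hx
    have h : b ∈ S.comap ((AddMonoidHom.mulRight v) - AddMonoidHom.mulLeft v) :=
      lieLowerCentral_induction (fun c hc u hu => lie_lie_mem hJ (ih hc) hu hv) hb
    exact h

/-- If `ad a` sends `S` into the centre, then it kills all higher terms of the series. -/
theorem lie_lieLowerCentral_eq_zero {S : Set R} {a : R} (ha : ∀ s ∈ S, ⁅a, s⁆ ∈ Subring.center R)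
    {n : ℕ} {b : R} (hb : b ∈ lieLowerCentral S (n + 1)) : ⁅a, b⁆ = 0 := by
  have step : ∀ n, (∀ c ∈ lieLowerCentral S n, ⁅a, c⁆ ∈ Subring.center R) →
      ∀ b ∈ lieLowerCentral S (n + 1), ⁅a, b⁆ = 0 := by
    intro n hn b hb
    have h : b ∈ (AddMonoidHom.mulLeft a - AddMonoidHom.mulRight a).ker := by
      refine lieLowerCentral_induction (fun c hc u hu => ?_) hb
      have e : ⁅a, ⁅c, u⁆⁆ = ⁅⁅a, c⁆, u⁆ - ⁅⁅a, u⁆, c⁆ := by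
        simp only [Ring.lie_def]; noncomm_ring
      rw [lie_eq_zero_of_mem_center (hn c hc), lie_eq_zero_of_mem_center (ha u hu),
        sub_self] at e
      exact e
    exact h
  induction n generalizing b with
  | zero => exact step 0 ha b hb
  | succ n ih => exact step _ (fun c hc => by rw [ih hc]; exact zero_mem _) b hb

/-- Let `S` generate `R`. If the last nonzero term of the Lie central series of `S` is
`γ^{n+3}(S)`, then it is central and has square zero. -/
theorem mul_eq_zero_of_mem_lieLowerCentral (h2 : IsUnit (2 : R))
    (hJ : ∀ x ∈ S, ∀ y ∈ S, x * y + y * x ∈ S) {n : ℕ}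
    (hc : lieLowerCentral (S : Set R) (n + 2) ⊆ Subring.center R) {x y : R}
    (hx : x ∈ lieLowerCentral (S : Set R) (n + 2)) (hy : y ∈ lieLowerCentral (S : Set R) (n + 2)) :
    x * y = 0 := by
  -- Both factors may be taken to be commutators `[a, s]` and `[b, v]` with `a, b ∈ γ^{n+2}(S)`. If
  -- `b` lies in `S`, swapping `s` and `b` gives the factor `[a, b] = 0`; otherwise `b` is itself a
  -- sum of commutators `[c, u]` with `c ∈ S`, and swapping `s` and `c` gives the factor `[a, c]`,
  -- which vanishes as soon as `c ∈ γ^2(S)`. The case `c ∈ γ^1(S) = S` is that of triple commutators.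
  have hca : ∀ a ∈ lieLowerCentral (S : Set R) (n + 1), ∀ s ∈ S, ⁅a, s⁆ ∈ Subring.center R :=
    fun a ha s hs => hc (lie_mem_lieLowerCentral ha hs)
  suffices key : ∀ a ∈ lieLowerCentral (S : Set R) (n + 1), ∀ s ∈ S,
      ∀ b ∈ lieLowerCentral (S : Set R) (n + 1), ∀ v ∈ S, ⁅a, s⁆ * ⁅b, v⁆ = 0 by
    have h : x ∈ (AddMonoidHom.mulRight y).ker := by
      refine lieLowerCentral_induction (fun a ha s hs => ?_) hx
      have h : y ∈ (AddMonoidHom.mulLeft ⁅a, s⁆).ker :=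
        lieLowerCentral_induction (fun b hb v hv => key a ha s hs b hb v hv) hy
      exact h
    exact h
  intro a ha s hs b hb v hv
  obtain ⟨k, hk⟩ := Nat.even_or_odd' n
  obtain rfl | hk := hk
  · have hb' : b ∈ (AddMonoidHom.mulLeft ⁅a, s⁆ |>.comp
        (AddMonoidHom.mulRight v - AddMonoidHom.mulLeft v)).ker := by
      refine lieLowerCentral_induction (fun c hc' u hu => ?_) hb
      change ⁅a, s⁆ * ⁅⁅c, u⁆, v⁆ = 0
      cases k with
      | zero =>
        have ha' : a ∈ (AddMonoidHom.mulRight ⁅⁅c, u⁆, v⁆ |>.comp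
            (AddMonoidHom.mulRight s - AddMonoidHom.mulLeft s)).ker :=
          lieLowerCentral_induction (fun p hp q hq => lie_lie_mul_lie_lie_eq_zero h2 hJ
            (fun s hs t ht u hu => hc (lie_mem_lieLowerCentral (lie_mem_lieLowerCentral hs ht) hu))
            hp hq hs hc' hu hv) ha
        exact ha'
      | succ k =>
        rw [lie_mul_lie_lie_swap h2 hJ (hca a ha) hs (lieLowerCentral_two_mul_subset hJ _ hc'),
          lie_lieLowerCentral_eq_zero (hca a ha) hc', zero_mul, neg_zero]
    exact hb'
  · have hbS : b ∈ S := by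
      have e : n + 1 = 2 * (k + 1) := by omega
      exact lieLowerCentral_two_mul_subset hJ (k + 1) (e ▸ hb)
    exact lie_mul_lie_eq_zero h2 hJ (hca a ha) hs hbS (lie_lieLowerCentral_eq_zero (hca a ha) hb) v

end LieSeries

/-! ### Unit groups of central square-zero extensions -/

/-- The descending series of the action of the unit group of `R` on `R` by conjugation: the next
term is generated by all `y⁻¹ v y - v` with `v` in the previous term and `y` a unit. The action is
unipotent if the series reaches zero. -/
def conjSeries (R : Type*) [Ring R] : ℕ → AddSubgroup R
  | 0 => ⊤
  | n + 1 => AddSubgroup.closure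
      {r : R | ∃ v ∈ conjSeries R n, ∃ y : Rˣ, r = ((y⁻¹ : Rˣ) : R) * v * y - v}

/-- The additive subgroup generated by the products `z * v` with `z ∈ Z` and `v ∈ V`. -/
def mulClosure {R : Type*} [Ring R] (Z : Set R) (V : AddSubgroup R) : AddSubgroup R :=
  AddSubgroup.closure {r : R | ∃ z ∈ Z, ∃ v ∈ V, r = z * v}

section Extension

open scoped commutatorElement

variable {R : Type*} [Ring R]

theorem map_conjSeries_le {R' : Type*} [Ring R'] (f : R →+* R') (n : ℕ) :
    conjSeries R n ≤ (conjSeries R' n).comap (f : R →+ R') := by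
  induction n with
  | zero => exact fun x _ => AddSubgroup.mem_top _
  | succ n ih =>
    refine (AddSubgroup.closure_le _).2 ?_
    rintro _ ⟨v, hv, y, rfl⟩
    exact AddSubgroup.subset_closure ⟨f v, ih hv, Units.map (f : R →* R') y, by simp⟩

variable {Z : Set R}

theorem span_le_mulClosure (hZ : Z ⊆ Subring.center R) {x : R} (hx : x ∈ Ideal.span Z) :
    x ∈ mulClosure Z ⊤ := by
  induction hx using Submodule.span_induction with
  | mem z hz => exact AddSubgroup.subset_closure ⟨z, hz, 1, AddSubgroup.mem_top _, by simp⟩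
  | zero => exact zero_mem _
  | add x y _ _ hx hy => exact add_mem hx hy
  | smul r x _ hx =>
    have h : mulClosure Z ⊤ ≤ (mulClosure Z ⊤).comap (AddMonoidHom.mulLeft r) := by
      refine (AddSubgroup.closure_le _).2 ?_
      rintro _ ⟨z, hz, v, -, rfl⟩
      refine AddSubgroup.subset_closure ⟨z, hz, r * v, AddSubgroup.mem_top _, ?_⟩
      change r * (z * v) = z * (r * v)
      rw [← mul_assoc, Subring.mem_center_iff.1 (hZ hz), mul_assoc]
    exact h hx

theorem mul_span_eq_zero (hZ : Z ⊆ Subring.center R) (hZZ : ∀ x ∈ Z, ∀ y ∈ Z, x * y = 0)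
    {z w : R} (hz : z ∈ Z) (hw : w ∈ Ideal.span Z) : z * w = 0 := by
  induction hw using Submodule.span_induction with
  | mem w hw => exact hZZ z hz w hw
  | zero => exact mul_zero z
  | add x y _ _ hx hy => rw [mul_add, hx, hy, add_zero]
  | smul r x _ hx =>
    rw [smul_eq_mul, ← mul_assoc, ← Subring.mem_center_iff.1 (hZ hz), mul_assoc, hx, mul_zero]

theorem mulClosure_le_span (hZ : Z ⊆ Subring.center R) (V : AddSubgroup R) :
    mulClosure Z V ≤ (Ideal.span Z).toAddSubgroup := by
  refine (AddSubgroup.closure_le _).2 ?_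
  rintro _ ⟨z, hz, v, -, rfl⟩
  change z * v ∈ Ideal.span Z
  rw [← Subring.mem_center_iff.1 (hZ hz)]
  exact Ideal.mul_mem_left _ _ (Ideal.subset_span hz)

/-- The ideal generated by a central set with square zero has square zero. -/
theorem span_mul_span_eq_zero (hZ : Z ⊆ Subring.center R) (hZZ : ∀ x ∈ Z, ∀ y ∈ Z, x * y = 0)
    {x w : R} (hx : x ∈ Ideal.span Z) (hw : w ∈ Ideal.span Z) : x * w = 0 := by
  induction hx using Submodule.span_induction with
  | mem z hz => exact mul_span_eq_zero hZ hZZ hz hw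
  | zero => exact zero_mul w
  | add x y _ _ hx hy => rw [add_mul, hx, hy, add_zero]
  | smul r x _ hx => rw [smul_eq_mul, mul_assoc, hx, mul_zero]

theorem conj_sub_mem_mulClosure (hZ : Z ⊆ Subring.center R) {n : ℕ} {v : R}
    (hv : v ∈ mulClosure Z (conjSeries R n)) (y : Rˣ) :
    ((y⁻¹ : Rˣ) : R) * v * y - v ∈ mulClosure Z (conjSeries R (n + 1)) := by
  have h : mulClosure Z (conjSeries R n) ≤ (mulClosure Z (conjSeries R (n + 1))).comap
      ((AddMonoidHom.mulRight (y : R)).comp (AddMonoidHom.mulLeft ((y⁻¹ : Rˣ) : R))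
        - AddMonoidHom.id R) := by
    refine (AddSubgroup.closure_le _).2 ?_
    rintro _ ⟨z, hz, v, hv, rfl⟩
    refine AddSubgroup.subset_closure
      ⟨z, hz, _, AddSubgroup.subset_closure ⟨v, hv, y, rfl⟩, ?_⟩
    change ((y⁻¹ : Rˣ) : R) * (z * v) * y - z * v = _
    rw [← mul_assoc _ z, Subring.mem_center_iff.1 (hZ hz)]
    noncomm_ring
  exact h hv

variable {R' : Type*} [Ring R'] {f : R →+* R'}

theorem conjSeries_add_le_mulClosure (hZ : Z ⊆ Subring.center R)
    (hf : ∀ x, f x = 0 → x ∈ Ideal.span Z) {N : ℕ} (hN : conjSeries R' N = ⊥) (k : ℕ) :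
    conjSeries R (N + k) ≤ mulClosure Z (conjSeries R k) := by
  induction k with
  | zero =>
    intro x hx
    have h := map_conjSeries_le f N hx
    rw [hN] at h
    exact span_le_mulClosure hZ (hf x h)
  | succ k ih =>
    refine (AddSubgroup.closure_le _).2 ?_
    rintro _ ⟨v, hv, y, rfl⟩
    exact conj_sub_mem_mulClosure hZ (ih hv) y

/-- Unipotence of the conjugation action lifts along a central square-zero extension: a central
factor `z ∈ Z` kills the kernel, so the action on `z R` factors through `R'`. -/
theorem conjSeries_eq_bot_of_extension (hZ : Z ⊆ Subring.center R)
    (hZZ : ∀ x ∈ Z, ∀ y ∈ Z, x * y = 0) (hf : ∀ x, f x = 0 → x ∈ Ideal.span Z)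
    {N : ℕ} (hN : conjSeries R' N = ⊥) : conjSeries R (N + N) = ⊥ := by
  rw [eq_bot_iff]
  refine (conjSeries_add_le_mulClosure hZ hf hN N).trans ((AddSubgroup.closure_le _).2 ?_)
  rintro _ ⟨z, hz, v, hv, rfl⟩
  have h := map_conjSeries_le f N hv
  rw [hN] at h
  exact mul_span_eq_zero hZ hZZ hz (hf v h)

/-- For units `1 + w` with `w` in a square-zero ideal, a group commutator with a unit `y` is
`1 - (y w y⁻¹ - w)`; this turns the lower central series of the units into the series of the
conjugation action. -/
theorem lowerCentralSeries_units_le (hZ : Z ⊆ Subring.center R)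
    (hZZ : ∀ x ∈ Z, ∀ y ∈ Z, x * y = 0) (hf : ∀ x, f x = 0 → x ∈ Ideal.span Z) {m : ℕ}
    (hm : (⊤ : Subgroup R'ˣ).lowerCentralSeries m = ⊥) (k : ℕ) {u : Rˣ}
    (hu : u ∈ (⊤ : Subgroup Rˣ).lowerCentralSeries (m + k)) :
    (u : R) - 1 ∈ mulClosure Z (conjSeries R k) := by
  induction k generalizing u with
  | zero =>
    have h : Units.map (f : R →* R') u ∈ (⊤ : Subgroup R'ˣ).lowerCentralSeries m := by
      have h := Subgroup.mem_map_of_mem (Units.map (f : R →* R')) hu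
      rw [Subgroup.map_lowerCentralSeries] at h
      exact Subgroup.lowerCentralSeries_mono m le_top h
    rw [hm, Subgroup.mem_bot] at h
    refine span_le_mulClosure hZ (hf _ ?_)
    have h' : f u = 1 := congrArg Units.val h
    rw [map_sub, h', map_one, sub_self]
  | succ k ih =>
    have hsq : ∀ {a b : R}, a ∈ Ideal.span Z → b ∈ Ideal.span Z → a * b = 0 :=
      span_mul_span_eq_zero hZ hZZ
    have hle := mulClosure_le_span hZ (conjSeries R k)
    have hle' := mulClosure_le_span hZ (conjSeries R (k + 1))
    rw [← add_assoc, Subgroup.mem_lowerCentralSeries_succ_iff] at hu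
    induction hu using Subgroup.closure_induction with
    | mem u hu =>
      obtain ⟨p, hp, y, -, rfl⟩ := hu
      have hw := ih hp
      have hc := conj_sub_mem_mulClosure hZ hw y⁻¹
      have hwI : (p : R) - 1 ∈ Ideal.span Z := hle hw
      rw [inv_inv] at hc
      have hpinv : ((p⁻¹ : Rˣ) : R) = 1 - ((p : R) - 1) := by
        refine Units.inv_eq_of_mul_eq_one_right ?_
        have e := hsq hwI hwI
        linear_combination (norm := noncomm_ring) -e
      have e : ((⁅p, y⁆ : Rˣ) : R) - 1 = -((y : R) * ((p : R) - 1) * ((y⁻¹ : Rˣ) : R)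
          - ((p : R) - 1)) := by
        have e1 := hsq hwI (Ideal.mul_mem_left _ (y : R) hwI)
        have e2 : (y : R) * ((y⁻¹ : Rˣ) : R) = 1 := y.mul_inv
        rw [commutatorElement_def, Units.val_mul, Units.val_mul, Units.val_mul, hpinv]
        linear_combination (norm := noncomm_ring)
          (-e1) * ((y⁻¹ : Rˣ) : R) + (p : R) * e2
      rw [e]
      exact neg_mem hc
    | one => simp [zero_mem]
    | mul x y _ _ hx hy =>
      have e := hsq (hle' hx) (hle' hy)
      have e' : ((x * y : Rˣ) : R) - 1 = ((x : R) - 1) + ((y : R) - 1) := by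
        rw [Units.val_mul]
        linear_combination (norm := noncomm_ring) e
      rw [e']
      exact add_mem hx hy
    | inv x _ hx =>
      have e := hsq (hle' hx) (hle' hx)
      have e' : ((x⁻¹ : Rˣ) : R) = 1 - ((x : R) - 1) := by
        refine Units.inv_eq_of_mul_eq_one_right ?_
        linear_combination (norm := noncomm_ring) -e
      have e'' : ((x⁻¹ : Rˣ) : R) - 1 = -((x : R) - 1) := by rw [e']; abel
      rw [e'']
      exact neg_mem hx

theorem lowerCentralSeries_units_eq_bot_of_extension (hZ : Z ⊆ Subring.center R)
    (hZZ : ∀ x ∈ Z, ∀ y ∈ Z, x * y = 0) (hf : ∀ x, f x = 0 → x ∈ Ideal.span Z) {m N : ℕ}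
    (hm : (⊤ : Subgroup R'ˣ).lowerCentralSeries m = ⊥) (hN : conjSeries R N = ⊥) :
    (⊤ : Subgroup Rˣ).lowerCentralSeries (m + N) = ⊥ := by
  rw [eq_bot_iff]
  intro u hu
  have h := lowerCentralSeries_units_le hZ hZZ hf hm N hu
  have h0 : mulClosure Z (conjSeries R N) ≤ ⊥ := by
    refine (AddSubgroup.closure_le _).2 ?_
    rintro _ ⟨z, -, v, hv, rfl⟩
    rw [hN, AddSubgroup.mem_bot] at hv
    rw [hv, mul_zero]
    exact zero_mem _
  exact Units.ext (sub_eq_zero.1 (h0 h))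

end Extension

/-! ### Rings with central commutators -/

section ClassTwo

open scoped commutatorElement

variable {R : Type*} [Ring R]

/-- If `S` generates `R`, is closed under the Jordan product and has central commutators, then all
commutators of `R` are central: `st = (s ∘ t + [s, t]) / 2` shows that `R` is spanned by `S` over
its centre. -/
theorem lie_mem_center_of_closure_eq_top (h2 : IsUnit (2 : R)) {S : AddSubgroup R} (h1 : 1 ∈ S)
    (hJ : ∀ x ∈ S, ∀ y ∈ S, x * y + y * x ∈ S) (hS : Subring.closure (S : Set R) = ⊤)
    (hc : ∀ s ∈ S, ∀ t ∈ S, ⁅s, t⁆ ∈ Subring.center R) (x y : R) :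
    ⁅x, y⁆ ∈ Subring.center R := by
  obtain ⟨h, hh⟩ := h2.exists_right_inv
  have hcen : h ∈ Subring.center R := by
    rw [Subring.mem_center_iff]
    intro g
    have e : h * 2 = 1 := by rw [← hh, two_mul, mul_two]
    have e' : (2 : R) * g = g * 2 := by rw [two_mul, mul_two]
    calc g * h = h * 2 * g * h := by rw [e, one_mul]
      _ = h * g * (2 * h) := by rw [mul_assoc h 2 g, e']; noncomm_ring
      _ = h * g := by rw [hh, mul_one]
  let V : AddSubgroup R :=
    AddSubgroup.closure {r : R | ∃ c ∈ Subring.center R, ∃ s ∈ S, r = c * s}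
  have hVS : ∀ s ∈ S, V ≤ V.comap (AddMonoidHom.mulLeft s) := by
    intro s hs
    refine (AddSubgroup.closure_le _).2 ?_
    rintro _ ⟨c, hcc, t, ht, rfl⟩
    have e : s * (c * t) = c * h * (s * t + t * s) + c * h * ⁅s, t⁆ * 1 := by
      have e1 : s * (c * t) = c * (s * t) := by
        rw [← mul_assoc, Subring.mem_center_iff.1 hcc, mul_assoc]
      have e2 : h * 2 = 1 := by rw [← hh, two_mul, mul_two]
      rw [e1, Ring.lie_def]
      linear_combination (norm := noncomm_ring) (-c) * e2 * (s * t)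
    change s * (c * t) ∈ V
    rw [e]
    exact add_mem
      (AddSubgroup.subset_closure ⟨_, mul_mem hcc hcen, _, hJ s hs t ht, rfl⟩)
      (AddSubgroup.subset_closure
        ⟨_, mul_mem (mul_mem hcc hcen) (hc s hs t ht), _, h1, rfl⟩)
  have hV : ∀ r : R, V ≤ V.comap (AddMonoidHom.mulLeft r) := by
    intro r
    have hr : r ∈ Subring.closure (S : Set R) := hS ▸ Subring.mem_top r
    induction hr using Subring.closure_induction with
    | mem s hs => exact hVS s hs
    | zero => intro v _; change 0 * v ∈ V; rw [zero_mul]; exact zero_mem _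
    | one => intro v hv; change 1 * v ∈ V; rwa [one_mul]
    | add x y _ _ hx hy =>
      intro v hv; change (x + y) * v ∈ V; rw [add_mul]; exact add_mem (hx hv) (hy hv)
    | neg x _ hx => intro v hv; change -x * v ∈ V; rw [neg_mul]; exact neg_mem (hx hv)
    | mul x y _ _ hx hy =>
      intro v hv; change x * y * v ∈ V; rw [mul_assoc]; exact hx (hy hv)
  have hVtop : ∀ r : R, r ∈ V := by
    intro r
    have h := hV r (AddSubgroup.subset_closure ⟨1, one_mem _, 1, h1, (one_mul 1).symm⟩)
    change r * 1 ∈ V at h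
    rwa [mul_one] at h
  have hxs : ∀ s ∈ S, V ≤ (Subring.center R).toAddSubgroup.comap
      (AddMonoidHom.mulRight s - AddMonoidHom.mulLeft s) := by
    intro s hs
    refine (AddSubgroup.closure_le _).2 ?_
    rintro _ ⟨c, hcc, t, ht, rfl⟩
    change ⁅c * t, s⁆ ∈ Subring.center R
    rw [lie_central_mul hcc]
    exact mul_mem hcc (hc t ht s hs)
  have hxy : V ≤ (Subring.center R).toAddSubgroup.comap
      (AddMonoidHom.mulLeft x - AddMonoidHom.mulRight x) := by
    refine (AddSubgroup.closure_le _).2 ?_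
    rintro _ ⟨c, hcc, t, ht, rfl⟩
    change ⁅x, c * t⁆ ∈ Subring.center R
    rw [central_mul_lie hcc]
    exact mul_mem hcc (hxs t ht (hVtop x))
  exact hxy (hVtop y)

/-- In a ring with central commutators `[a, b][c, d] = -[a, c][b, d]`, because `[a, bc]` is
central. -/
theorem lie_mul_lie_swap_of_central (hc : ∀ x y : R, ⁅x, y⁆ ∈ Subring.center R)
    (a b c d : R) : ⁅a, b⁆ * ⁅c, d⁆ = -(⁅a, c⁆ * ⁅b, d⁆) := by
  have h := lie_eq_zero_of_mem_center (hc a (b * c)) d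
  have e : ⁅⁅a, b * c⁆, d⁆ = ⁅a, b⁆ * ⁅c, d⁆ + ⁅b, d⁆ * ⁅a, c⁆ + ⁅⁅a, b⁆, d⁆ * c
      + b * ⁅⁅a, c⁆, d⁆ := by
    simp only [Ring.lie_def]; noncomm_ring
  rw [e, lie_eq_zero_of_mem_center (hc a b), lie_eq_zero_of_mem_center (hc a c), zero_mul,
    mul_zero, add_zero, add_zero, Subring.mem_center_iff.1 (hc a c)] at h
  exact eq_neg_of_add_eq_zero_left h

theorem lie_inv_mul_lie_eq_zero (hc : ∀ x y : R, ⁅x, y⁆ ∈ Subring.center R)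
    (x : Rˣ) (a b : R) : ⁅((x⁻¹ : Rˣ) : R), a⁆ * ⁅(x : R), b⁆ = 0 := by
  have e : ⁅((x⁻¹ : Rˣ) : R), (x : R)⁆ = 0 := by
    rw [Ring.lie_def, x.inv_mul, x.mul_inv, sub_self]
  rw [lie_mul_lie_swap_of_central hc, e, zero_mul, neg_zero]

theorem conjSeries_two_eq_bot_of_central (hc : ∀ x y : R, ⁅x, y⁆ ∈ Subring.center R) :
    conjSeries R 2 = ⊥ := by
  have h1 : ∀ y : Rˣ, conjSeries R 1 ≤ ((AddMonoidHom.mulRight (y : R)).comp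
      (AddMonoidHom.mulLeft ((y⁻¹ : Rˣ) : R)) - AddMonoidHom.id R).ker := by
    intro y
    refine (AddSubgroup.closure_le _).2 ?_
    rintro _ ⟨v, -, x, rfl⟩
    change ((y⁻¹ : Rˣ) : R) * (((x⁻¹ : Rˣ) : R) * v * x - v) * y
      - (((x⁻¹ : Rˣ) : R) * v * x - v) = 0
    have e : ((x⁻¹ : Rˣ) : R) * v * x - v = ((x⁻¹ : Rˣ) : R) * ⁅v, (x : R)⁆ := by
      rw [Ring.lie_def, mul_sub, ← mul_assoc, x.inv_mul_cancel_left]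
    have e0 : ⁅((x⁻¹ : Rˣ) : R), (y : R)⁆ * ⁅v, (x : R)⁆ = 0 := by
      have h := lie_inv_mul_lie_eq_zero hc x (y : R) v
      rw [Ring.lie_def (x : R) v, ← neg_sub, mul_neg, neg_eq_zero] at h
      exact h
    have e1 : ⁅((x⁻¹ : Rˣ) : R) * ⁅v, (x : R)⁆, (y : R)⁆ = 0 := by
      rw [Subring.mem_center_iff.1 (hc v x), lie_central_mul (hc v x),
        ← Subring.mem_center_iff.1 (hc v x), e0]
    rw [e, mul_assoc, sub_eq_zero.1 e1, y.inv_mul_cancel_left, sub_self]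
  rw [eq_bot_iff]
  refine (AddSubgroup.closure_le _).2 ?_
  rintro _ ⟨v, hv, y, rfl⟩
  exact h1 y hv

theorem lowerCentralSeries_units_two_eq_bot_of_central
    (hc : ∀ x y : R, ⁅x, y⁆ ∈ Subring.center R) :
    (⊤ : Subgroup Rˣ).lowerCentralSeries 2 = ⊥ := by
  refine Subgroup.lowerCentralSeries_succ_eq_bot _ ?_
  rw [Subgroup.lowerCentralSeries_succ, Subgroup.lowerCentralSeries_zero, Subgroup.commutator_le]
  intro x _ y _
  rw [Subgroup.mem_center_iff]
  intro w
  have e : ((⁅x, y⁆ : Rˣ) : R) = 1 + ((x⁻¹ : Rˣ) : R) * ((y⁻¹ : Rˣ) : R) * ⁅(x : R), (y : R)⁆ := by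
    have e1 : ((⁅x, y⁆ : Rˣ) : R)
        = 1 + ⁅(x : R), (y : R)⁆ * (((x⁻¹ : Rˣ) : R) * ((y⁻¹ : Rˣ) : R)) := by
      rw [commutatorElement_def, Ring.lie_def, sub_mul, mul_assoc (y : R), x.mul_inv_cancel_left,
        y.mul_inv]
      simp only [Units.val_mul, mul_assoc]
      abel
    rw [e1, Subring.mem_center_iff.1 (hc x y)]
  have ex := lie_inv_mul_lie_eq_zero hc x (w : R) y
  have ey : ⁅((y⁻¹ : Rˣ) : R), (w : R)⁆ * ⁅(x : R), (y : R)⁆ = 0 := by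
    have h := lie_inv_mul_lie_eq_zero hc y (w : R) x
    rw [Ring.lie_def (y : R) x, ← neg_sub, mul_neg, neg_eq_zero] at h
    exact h
  have e2 : ⁅((x⁻¹ : Rˣ) : R) * ((y⁻¹ : Rˣ) : R), (w : R)⁆ * ⁅(x : R), (y : R)⁆ = 0 := by
    have e3 : ⁅((x⁻¹ : Rˣ) : R) * ((y⁻¹ : Rˣ) : R), (w : R)⁆
        = ((x⁻¹ : Rˣ) : R) * ⁅((y⁻¹ : Rˣ) : R), (w : R)⁆
          + ((y⁻¹ : Rˣ) : R) * ⁅((x⁻¹ : Rˣ) : R), (w : R)⁆ := by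
      rw [Subring.mem_center_iff.1 (hc ((x⁻¹ : Rˣ) : R) w) ((y⁻¹ : Rˣ) : R)]
      simp only [Ring.lie_def]; noncomm_ring
    rw [e3, add_mul, mul_assoc, mul_assoc, ex, ey, mul_zero, mul_zero, add_zero]
  refine Units.ext ?_
  rw [Units.val_mul, Units.val_mul, e]
  have e4 := Subring.mem_center_iff.1 (hc x y) (w : R)
  rw [Ring.lie_def (_ * _) (w : R)] at e2
  have e5 : ((x⁻¹ : Rˣ) : R) * ((y⁻¹ : Rˣ) : R) * ⁅(x : R), (y : R)⁆ * w
      = ((x⁻¹ : Rˣ) : R) * ((y⁻¹ : Rˣ) : R) * w * ⁅(x : R), (y : R)⁆ := by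
    rw [mul_assoc, ← e4, mul_assoc _ (w : R)]
  rw [mul_add, add_mul, e5, ← sub_eq_zero]
  linear_combination (norm := noncomm_ring) -e2

end ClassTwo

/-! ### Rings generated by a Lie nilpotent Jordan-closed subgroup -/

theorem isTwoSided_span_of_subset_center {R : Type*} [Ring R] {Z : Set R}
    (hZ : Z ⊆ Subring.center R) : (Ideal.span Z).IsTwoSided := by
  refine ⟨fun {a} b ha => ?_⟩
  induction ha using Submodule.span_induction with
  | mem z hz =>
    rw [← Subring.mem_center_iff.1 (hZ hz)]
    exact Ideal.mul_mem_left _ _ (Ideal.subset_span hz)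
  | zero => rw [zero_mul]; exact zero_mem _
  | add x y _ _ hx hy => rw [add_mul]; exact add_mem hx hy
  | smul r x _ hx => rw [smul_eq_mul, mul_assoc]; exact Ideal.mul_mem_left _ _ hx

/-- A ring with `1/2` generated by a Jordan-closed additive subgroup whose Lie central series
reaches zero has a nilpotent unit group, acting unipotently by conjugation. The induction divides
out the ideal generated by the last nonzero term of the series. -/
theorem exists_conjSeries_and_lowerCentralSeries_units_eq_bot.{u} (n : ℕ) :
    ∀ (R : Type u) [Ring R] (S : AddSubgroup R), IsUnit (2 : R) → 1 ∈ S →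
      (∀ x ∈ S, ∀ y ∈ S, x * y + y * x ∈ S) → Subring.closure (S : Set R) = ⊤ →
      lieLowerCentral (S : Set R) (n + 2) = {0} →
      (∃ N, conjSeries R N = ⊥) ∧ ∃ m, (⊤ : Subgroup Rˣ).lowerCentralSeries m = ⊥ := by
  induction n with
  | zero =>
    intro R _ S h2 h1 hJ hS h
    have hc := lie_mem_center_of_closure_eq_top h2 h1 hJ hS fun s hs t ht =>
      mem_center_of_forall_lie_eq_zero hS fun u hu =>
        h.subset (lie_mem_lieLowerCentral (lie_mem_lieLowerCentral hs ht) hu)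
    exact ⟨⟨2, conjSeries_two_eq_bot_of_central hc⟩,
      ⟨2, lowerCentralSeries_units_two_eq_bot_of_central hc⟩⟩
  | succ n ih =>
    intro R _ S h2 h1 hJ hS h
    have hZ : lieLowerCentral (S : Set R) (n + 2) ⊆ Subring.center R := fun z hz =>
      mem_center_of_forall_lie_eq_zero hS fun u hu => h.subset (lie_mem_lieLowerCentral hz hu)
    have hZZ : ∀ x ∈ lieLowerCentral (S : Set R) (n + 2),
        ∀ y ∈ lieLowerCentral (S : Set R) (n + 2), x * y = 0 := fun x hx y hy =>
      mul_eq_zero_of_mem_lieLowerCentral h2 hJ hZ hx hy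
    have := isTwoSided_span_of_subset_center hZ
    let f := Ideal.Quotient.mk (Ideal.span (lieLowerCentral (S : Set R) (n + 2)))
    have hf : ∀ x, f x = 0 → x ∈ Ideal.span (lieLowerCentral (S : Set R) (n + 2)) :=
      fun x hx => Ideal.Quotient.eq_zero_iff_mem.1 hx
    obtain ⟨⟨N, hN⟩, m, hm⟩ := ih _ (S.map f.toAddMonoidHom)
      (map_ofNat f 2 ▸ h2.map f) ⟨1, h1, map_one f⟩
      (by
        rintro _ ⟨x, hx, rfl⟩ _ ⟨y, hy, rfl⟩
        exact ⟨x * y + y * x, hJ x hx y hy, by simp⟩)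
      (by
        rw [AddSubgroup.coe_map]
        change Subring.closure (f '' S) = ⊤
        rw [← RingHom.map_closure, hS, ← RingHom.range_eq_map, RingHom.range_eq_top]
        exact Ideal.Quotient.mk_surjective)
      (by
        rw [AddSubgroup.coe_map]
        change lieLowerCentral (f '' S) (n + 2) = {0}
        rw [← image_lieLowerCentral]
        refine Set.Subset.antisymm ?_ ?_
        · rintro _ ⟨z, hz, rfl⟩
          exact Ideal.Quotient.eq_zero_iff_mem.2 (Ideal.subset_span hz)
        · rintro _ rfl
          exact ⟨0, AddSubgroup.zero_mem _, map_zero f⟩)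
    have hN' := conjSeries_eq_bot_of_extension hZ hZZ hf hN
    exact ⟨⟨_, hN'⟩, _, lowerCentralSeries_units_eq_bot_of_extension hZ hZZ hf hm hN'⟩

theorem groupLowerCentral_subset_map {U V : Type*} [Group U] [Group V] (f : V →* U) {H : Set U}
    (hH : H ⊆ Set.range f) (n : ℕ) :
    groupLowerCentral H n ⊆ ((⊤ : Subgroup V).lowerCentralSeries n).map f := by
  induction n with
  | zero =>
    intro u hu
    obtain ⟨v, rfl⟩ := hH hu
    exact ⟨v, Subgroup.mem_top v, rfl⟩
  | succ n ih =>
    refine (Subgroup.closure_le _).2 ?_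
    rintro _ ⟨x, hx, y, hy, rfl⟩
    obtain ⟨a, ha, rfl⟩ := ih hx
    obtain ⟨b, rfl⟩ := hH hy
    refine ⟨_, Subgroup.commutator_mem_commutator (inv_mem ha) (Subgroup.mem_top b⁻¹), ?_⟩
    simp [commutatorElement_def]

/-- Let `S` be a Jordan-closed additive subgroup of a ring, with `1/2 ∈ S`. If `S` is Lie
nilpotent, then any set of units that lie in `S` together with their inverses is nilpotent. -/
theorem isNilpotentSet_of_isLieNilpotentSet {R : Type*} [Ring R] {S : AddSubgroup R}
    (h1 : 1 ∈ S) {h : R} (hh : 2 * h = 1) (hhS : h ∈ S)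
    (hJ : ∀ x ∈ S, ∀ y ∈ S, x * y + y * x ∈ S) (hL : IsLieNilpotentSet (S : Set R))
    {H : Set Rˣ} (hH : ∀ u ∈ H, (u : R) ∈ S ∧ ((u⁻¹ : Rˣ) : R) ∈ S) : IsNilpotentSet H := by
  obtain ⟨n, hn⟩ := hL
  -- Everything takes place in the subring generated by `S`.
  let A := Subring.closure (S : Set R)
  have hSA : ∀ {s}, s ∈ S → s ∈ A := fun hs => Subring.subset_closure hs
  let T : AddSubgroup A := S.comap (A.subtype : A →+ R)
  have hcoe : A.subtype '' (T : Set A) = S := by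
    ext s
    exact ⟨fun ⟨x, hx, e⟩ => e ▸ hx, fun hs => ⟨⟨s, hSA hs⟩, hs, rfl⟩⟩
  have hinj : Function.Injective A.subtype := Subtype.val_injective
  have h2' : h * 2 = 1 := by rw [← hh, two_mul, mul_two]
  have hT : lieLowerCentral (T : Set A) (n + 2) = {0} := by
    apply hinj.image_injective
    rw [image_lieLowerCentral, hcoe, Set.image_singleton, map_zero]
    exact lieLowerCentral_succ_eq_zero (lieLowerCentral_succ_eq_zero hn)
  obtain ⟨-, m, hm⟩ := exists_conjSeries_and_lowerCentralSeries_units_eq_bot n A T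
    ⟨⟨2, ⟨h, hSA hhS⟩, Subtype.ext hh, Subtype.ext h2'⟩, rfl⟩ h1
    (fun x hx y hy => hJ x hx y hy)
    (by
      rw [eq_top_iff]
      intro x _
      have hx : (x : R) ∈ (Subring.closure (T : Set A)).map A.subtype := by
        rw [RingHom.map_closure, hcoe]
        exact x.2
      obtain ⟨y, hy, e⟩ := hx
      exact hinj e ▸ hy)
    hT
  have hrange : H ⊆ Set.range (Units.map (A.subtype : A →* R)) := fun u hu =>
    ⟨⟨⟨u, hSA (hH u hu).1⟩, ⟨((u⁻¹ : Rˣ) : R), hSA (hH u hu).2⟩, Subtype.ext u.mul_inv,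
      Subtype.ext u.inv_mul⟩, Units.ext rfl⟩
  refine ⟨m + 1, Set.Subset.antisymm (fun u hu => ?_) ?_⟩
  · obtain ⟨v, hv, rfl⟩ := groupLowerCentral_subset_map _ hrange _ hu
    have hv' := Subgroup.lowerCentralSeries_antitone ⊤ m.le_succ hv
    rw [hm, Subgroup.mem_bot] at hv'
    rw [hv', map_one]
    exact Set.mem_singleton 1
  · rintro _ rfl
    exact Subgroup.one_mem _

/-! ### The oriented classical involution -/

section Involution

variable {F G : Type*} [Field F] [Group G] (σ : G →* ℤˣ)

theorem orientedInvolution_single (g : G) (r : F) :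
    orientedInvolution σ (MonoidAlgebra.single g r)
      = MonoidAlgebra.single g⁻¹ (r * (((σ g : ℤˣ) : ℤ) : F)) := by
  rw [orientedInvolution, MonoidAlgebra.coeff_single, Finsupp.sum_single_index]
  simp

theorem orientedInvolution_add (a b : MonoidAlgebra F G) :
    orientedInvolution σ (a + b) = orientedInvolution σ a + orientedInvolution σ b := by
  rw [orientedInvolution, MonoidAlgebra.coeff_add, Finsupp.sum_add_index']
  · rfl
  · simp
  · intro g r s
    rw [add_mul, MonoidAlgebra.single_add]

theorem orientedInvolution_zero : orientedInvolution σ (0 : MonoidAlgebra F G) = 0 := by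
  simpa using orientedInvolution_add σ (0 : MonoidAlgebra F G) 0

theorem orientedInvolution_one : orientedInvolution σ (1 : MonoidAlgebra F G) = 1 := by
  rw [MonoidAlgebra.one_def, orientedInvolution_single]
  simp

theorem orientedInvolution_neg (a : MonoidAlgebra F G) :
    orientedInvolution σ (-a) = -orientedInvolution σ a := by
  refine eq_neg_of_add_eq_zero_left ?_
  rw [← orientedInvolution_add, neg_add_cancel, orientedInvolution_zero]

theorem orientedInvolution_mul (a b : MonoidAlgebra F G) :
    orientedInvolution σ (a * b) = orientedInvolution σ b * orientedInvolution σ a := by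
  induction a using MonoidAlgebra.induction_linear with
  | zero => rw [zero_mul, orientedInvolution_zero, mul_zero]
  | add a a' ha ha' => rw [add_mul, orientedInvolution_add, ha, ha', orientedInvolution_add, mul_add]
  | single g r =>
    induction b using MonoidAlgebra.induction_linear with
    | zero => rw [mul_zero, orientedInvolution_zero, zero_mul]
    | add b b' hb hb' =>
      rw [mul_add, orientedInvolution_add, hb, hb', orientedInvolution_add, add_mul]
    | single h s =>
      rw [MonoidAlgebra.single_mul_single, orientedInvolution_single, orientedInvolution_single,
        orientedInvolution_single, MonoidAlgebra.single_mul_single, mul_inv_rev, map_mul]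
      congr 1
      push_cast
      ring

theorem orientedInvolution_inv (u : (MonoidAlgebra F G)ˣ) (hu : u ∈ symmetricUnits F σ) :
    orientedInvolution σ ((u⁻¹ : (MonoidAlgebra F G)ˣ) : MonoidAlgebra F G)
      = ((u⁻¹ : (MonoidAlgebra F G)ˣ) : MonoidAlgebra F G) := by
  have hu' : orientedInvolution σ (u : MonoidAlgebra F G) = u := hu
  refine (Units.inv_eq_of_mul_eq_one_right ?_).symm
  calc (u : MonoidAlgebra F G) * orientedInvolution σ ((u⁻¹ : (MonoidAlgebra F G)ˣ) : _)
      = orientedInvolution σ (u : MonoidAlgebra F G)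
          * orientedInvolution σ ((u⁻¹ : (MonoidAlgebra F G)ˣ) : _) := by rw [hu']
    _ = 1 := by rw [← orientedInvolution_mul, u.inv_mul, orientedInvolution_one]

end Involution

end OrientedGroupAlgebra

theorem mainTheorem2 {F G : Type*} [Field F] [Group G] (hF : ringChar F ≠ 2)
    (σ : G →* ℤˣ) (hσ : σ ≠ 1)
    (hQ : ∃ f : QuaternionGroup 2 →* G, Function.Injective f)
    (hLie : OrientedGroupAlgebra.IsLieNilpotentSet
      (OrientedGroupAlgebra.symmetricElements F σ)) :
    OrientedGroupAlgebra.IsNilpotentSet (OrientedGroupAlgebra.symmetricUnits F σ) := by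
  let S : AddSubgroup (MonoidAlgebra F G) :=
    { carrier := OrientedGroupAlgebra.symmetricElements F σ
      add_mem' := fun {a b} ha hb => by
        change OrientedGroupAlgebra.orientedInvolution σ (a + b) = a + b
        rw [OrientedGroupAlgebra.orientedInvolution_add, ha, hb]
      zero_mem' := OrientedGroupAlgebra.orientedInvolution_zero σ
      neg_mem' := fun {a} ha => by
        change OrientedGroupAlgebra.orientedInvolution σ (-a) = -a
        rw [OrientedGroupAlgebra.orientedInvolution_neg, ha] }
  have h2 : (2 : F) ≠ 0 := Ring.two_ne_zero hF
  refine OrientedGroupAlgebra.isNilpotentSet_of_isLieNilpotentSet (S := S)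
    (h := MonoidAlgebra.single 1 2⁻¹) (OrientedGroupAlgebra.orientedInvolution_one σ) ?_ ?_ ?_ hLie
    fun u hu => ⟨hu, OrientedGroupAlgebra.orientedInvolution_inv σ u hu⟩
  · rw [two_mul, ← MonoidAlgebra.single_add, ← two_mul, mul_inv_cancel₀ h2, MonoidAlgebra.one_def]
  · change OrientedGroupAlgebra.orientedInvolution σ _ = _
    rw [OrientedGroupAlgebra.orientedInvolution_single]
    simp
  · intro x hx y hy
    change OrientedGroupAlgebra.orientedInvolution σ (x * y + y * x) = x * y + y * x
    have hx' : OrientedGroupAlgebra.orientedInvolution σ x = x := hx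
    have hy' : OrientedGroupAlgebra.orientedInvolution σ y = y := hy
    rw [OrientedGroupAlgebra.orientedInvolution_add, OrientedGroupAlgebra.orientedInvolution_mul,
      OrientedGroupAlgebra.orientedInvolution_mul, hx', hy', add_comm]
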